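/- **Setting.** Let $K$ be a number field that is Galois over $\mathbb{Q}$, with ring of integers $\mathcal{O}$ and discriminant $D$. A rational prime $p$ is unramified if all prime ideals of $\mathcal{O}$ above $p$ are unramified over $p$. For a prime ideal $\mathfrak{p}\mid p$ with $p$ unramified, let $\mathcal{O}_\mathfrak{p}$ be the ring of $\mathfrak{p}$-adic integers in the completion $K_\mathfrak{p}$, and let $\mathrm{Frob}_\mathfrak{p}$ be the Frobenius element at $\mathfrak{p}$: the unique $\sigma\in\mathrm{Gal}(K/\mathbb{Q})$ with $\sigma(x)\equiv x^p \bmod \mathfrak{p}$ for all $x\in\mathcal{O}$ (it extends continuously to $K_\mathfrak{p}$). It acts on power series coefficientwise, fixing $z$. For $x,y\in K_\mathfrak{p}$ and $e\ge 0$, write $x\equiv y \bmod p^e\mathcal{O}_\mathfrak{p}$ if $x-y\in p^e\mathcal{O}_\mathfrak{p}$. For a Laurent series $F$ let $[F]_n$ be its $n$-th coefficient; let $\delta = z\frac{d}{dz}$, and let $\int\colon z^n\mapsto z^n/n$ ($n\geq 1$) on $zK[[z]]$. For $V\in zK[[z]]$ and $\nu\in\mathbb{Q}$, the framing $V^{(+,\nu)}=\sum_{n\ge1}a_n^+z^n$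 is $\delta$ of the generating series $\sum_{n\geq 1} y_nz^n$ of the Bell transform $$y_n=\frac1{n!}\sum_{k=1}^n(\nu n)^{k-1}B_{n,k}(1!\,x_1,2!\,x_2,\dots),\qquad x_j=\Big[\int V\Big]_j,$$ where the partial Bell polynomials $B_{n,k}$ are given by $\frac1{k!}\big(\sum_{j\ge1}X_j\frac{z^j}{j!}\big)^k=\sum_{n\ge k}B_{n,k}(X_1,X_2,\dots)\frac{z^n}{n!}$. A series $V=\sum_{n\ge1}a_nz^n\in zK[[z]]$ is a $3$-function, $V\in\mathcal{S}^3(K|\mathbb{Q})$, if for every unramified prime $p$ and every $\mathfrak{p}\mid p$, all $a_n$ lie in $\mathcal{O}_\mathfrak{p}$ and $$\mathrm{Frob}_\mathfrak{p}(a_{mp^{r-1}})\equiv a_{mp^r}\mod p^{3r}\mathcal{O}_\mathfrak{p}\qquad\text{for all } m,r\ge1.$$ **Lemma.** Let $V\in\mathcal{S}^3(K|\mathbb{Q})$ and $\nu\in\mathbb{Z}[D^{-1}]$, and let $a_n^+=[V^{(+,\nu)}]_n$. Let $p$ be an unramified prime, $\mathfrak{p}\mid p$ a prime ideal of $\mathcal{O}$,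 and $n\ge1$. 1. Unless $p=2$ and $n$ is odd, $$\frac{2}{p^2n^2}\big(\mathrm{Frob}_\mathfrak{p}(a_n^+)-a_{pn}^+\big)\equiv \nu\left[\delta\big(\mathrm{Frob}_\mathfrak{p}V(z^p)+V(z)\big)\cdot\Big(\frac{\exp(\nu\int V(z))}{z}\Big)^{pn}\cdot\int\!{}^3\big(\mathrm{Frob}_\mathfrak{p}V(z^p)-V(z)\big)\right]_0$$ modulo $p^{\mathrm{ord}_p(pn)-\delta_{3,p}}\mathcal{O}_\mathfrak{p}$, where $\delta_{3,p}$ is the Kronecker symbol and $\int^3$ is $\int$ applied three times. 2. If $p=2$ and $n$ is odd, then $\mathrm{Frob}_\mathfrak{p}(a_n^+)\equiv a_{2n}^+ \mod 2\mathcal{O}_\mathfrak{p}$. -/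

import Mathlib

open scoped NumberField Nat

noncomputable section

namespace Framing

open PowerSeries IsDedekindDomain

section Formal

variable {F : Type*} [Field F]

/-- The Euler operator `δ = z d/dz` on formal power series, `∑ rₙ zⁿ ↦ ∑ n rₙ zⁿ`. -/
def euler (f : F⟦X⟧) : F⟦X⟧ := PowerSeries.mk fun n => (n : F) * coeff n f

/-- Logarithmic integration `∫`, `∑ rₙ zⁿ ↦ ∑ (rₙ / n) zⁿ`, used on series without constant
term; the constant term of the result is `0`. -/
def logInt (f : F⟦X⟧) : F⟦X⟧ := PowerSeries.mk fun n => coeff n f / (n : F)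

/-- The generating series `∑_{n ≥ 1} xₙ zⁿ` of a sequence indexed by the positive integers
(the value `x 0` is ignored). -/
def genSeries (x : ℕ → F) : F⟦X⟧ := PowerSeries.mk fun n => if n = 0 then 0 else x n

/-- The value at `(x₁, x₂, …)` of the partial Bell polynomial `B_{n,k}`, which is defined by
`(1/k!) (∑_{j ≥ 1} x_j z^j / j!)^k = ∑_{n ≥ k} B_{n,k}(x) zⁿ / n!`. -/
def partialBell (n k : ℕ) (x : ℕ → F) : F :=
  (n ! : F) * coeff n (((k ! : F)⁻¹) • (genSeries fun j => x j / (j ! : F)) ^ k)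

/-- The Bell transformation with parameters `(a, b, c, d)`, sending `x` to
`yₙ = (1/n!) ∑_{k=1}^n [∏_{j=1}^{k-1} (a n + b k + c j + d)] B_{n,k}(1! x₁, 2! x₂, …)`. -/
def bellTransform (a b c d : F) (x : ℕ → F) (n : ℕ) : F :=
  ((n ! : F)⁻¹) * ∑ k ∈ Finset.Icc 1 n,
    (∏ j ∈ Finset.Icc 1 (k - 1), (a * (n : F) + b * (k : F) + c * (j : F) + d)) *
      partialBell n k fun i => (i ! : F) * x i

/-- The framing operator `Φ⁺(ν, -)`, `V ↦ V^{(+,ν)}`: apply `∫`, take the sequence of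
coefficients, apply the Bell transformation with parameters `(ν, 0, 0, 0)`, take the generating
series, and apply `δ`. -/
def framingPlus (ν : F) (V : F⟦X⟧) : F⟦X⟧ :=
  euler (genSeries (bellTransform ν 0 0 0 fun n => coeff n (logInt V)))

end Formal

section Arithmetic

variable (K : Type*) [Field K] [NumberField K]

/-- The rational prime `p` is unramified in `K`: all primes of `𝓞 K` above `p` are unramified. -/
def UnramifiedPrime (p : ℕ) : Prop :=
  Algebra.IsUnramifiedIn (𝓞 K) (Ideal.span {(p : ℤ)})

variable {K}

/-- `x` lies in the ring `𝓞_v` of `v`-adic integers, the valuation ring of the completion `K_v`. -/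
def IsLocInt (v : HeightOneSpectrum (𝓞 K)) (x : K) : Prop :=
  algebraMap K (v.adicCompletion K) x ∈ v.adicCompletionIntegers K

/-- `x ≡ y mod p^e 𝓞_v`: the difference lies in the subset `p^e 𝓞_v` of the completion `K_v`. -/
def LocCongr (v : HeightOneSpectrum (𝓞 K)) (p e : ℕ) (x y : K) : Prop :=
  ∃ c ∈ v.adicCompletionIntegers K,
    algebraMap K (v.adicCompletion K) (x - y) = (p : v.adicCompletion K) ^ e * c

variable [IsGalois ℚ K]

/-- The Frobenius element at `v` in `Gal(K/ℚ)`: it satisfies `Fr x ≡ x^p mod v` for all `x ∈ 𝓞 K`,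
where `p` is the rational prime below `v`; it is unique if `p` is unramified. On `K ⊆ K_v` it
agrees with its continuous extension to `K_v`. -/
def frob (v : HeightOneSpectrum (𝓞 K)) : Gal(K/ℚ) :=
  arithFrobAt ℤ Gal(K/ℚ) v.asIdeal

/-- The Frobenius acting on the coefficients of a power series (and fixing the variable). -/
def frobSeries (v : HeightOneSpectrum (𝓞 K)) (V : K⟦X⟧) : K⟦X⟧ :=
  PowerSeries.map (frob v : K →+* K) V

/-- The local `s`-function property of `V = ∑_{n ≥ 1} aₙ zⁿ` at the prime `p`. -/
def LocalSFunction (s : ℕ) (V : K⟦X⟧) (p : ℕ) : Prop :=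
  UnramifiedPrime K p ∧
    ∀ v : HeightOneSpectrum (𝓞 K), (p : 𝓞 K) ∈ v.asIdeal →
      (∀ n : ℕ, 0 < n → IsLocInt v (coeff n V)) ∧
      ∀ m r : ℕ, 0 < m → 0 < r →
        LocCongr v p (s * r) (frob v (coeff (m * p ^ (r - 1)) V)) (coeff (m * p ^ r) V)

/-- `V ∈ 𝒮^s(K|ℚ)`: `V ∈ z K⟦z⟧` is the generating series of an `s`-sequence. -/
def IsSFunction (s : ℕ) (V : K⟦X⟧) : Prop :=
  constantCoeff V = 0 ∧
    ∀ p : ℕ, p.Prime → UnramifiedPrime K p → LocalSFunction s V p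

/-- The Laurent series `exp(ν ∫V) / z`. -/
def expOverZ (ν : K) (V : K⟦X⟧) : LaurentSeries K :=
  (((PowerSeries.exp K).subst (ν • logInt V) : K⟦X⟧) : LaurentSeries K) *
    HahnSeries.single (-1 : ℤ) (1 : K)

/-- `Frob V(z^p)`. -/
def frobPow (v : HeightOneSpectrum (𝓞 K)) (p : ℕ) (V : K⟦X⟧) : K⟦X⟧ :=
  (frobSeries v V).subst ((X : K⟦X⟧) ^ p)

/-- The constant term
`[δ(Frob V(z^p) + V(z)) ⬝ (exp(ν ∫V)/z)^{pn} ⬝ ∫³(Frob V(z^p) - V(z))]₀`. -/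
def framingTerm (v : HeightOneSpectrum (𝓞 K)) (p n : ℕ) (ν : K) (V : K⟦X⟧) : K :=
  ((euler (frobPow v p V + V) : LaurentSeries K) *
    expOverZ ν V ^ (p * n) *
    (logInt (logInt (logInt (frobPow v p V - V))) : LaurentSeries K)).coeff 0

end Arithmetic

end Framing

end

noncomputable section

namespace Framing

open PowerSeries IsDedekindDomain

/-! ### Formal calculus of `δ`, `∫` and `exp`, and the closed form of framing. -/

section FormalSeries

variable {F : Type*} [Field F]

/-! Summing the Bell polynomials gives `aₙ⁺ = [V exp(νn∫V)]ₙ` (`coeff_framingPlus`). Put `N = pn`,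
`W = ∫V`, `U = Frob V(z^p)`, `H = ∫(U - V)`, `G = ∫³(U - V)`, `E = exp(νNW)`. The Frobenius lift
sends `W` to `p(W + H)`, so `Frob(aₙ⁺)` is the `N`-th coefficient of `U exp(νN(W + H))`. Expanding
in `H` (`coeff_sub_eq_sum`), `Frob(aₙ⁺) - a_N⁺` is `N` times the sum over `k ≥ 0` of `(νN)^k /
(k+1)! · [H^(k+1) E]_N`.

Two integrality facts control this sum. `G`, hence `H = δ²G`, is integral by the 3-function property
(`logInt_cube_mem`), and `E` is integral by the Dieudonné–Dwork criterion (`expSeries_smul_mem`).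
After multiplication by `2/N²`, the terms `k = 0, 1` give the bracket of the lemma modulo `N`, by
integration by parts (`exists_quadratic_term_eq`). The terms `k ≥ 2` vanish modulo `N`, up to one
factor 3 when `p = 3`, by Legendre's bound on factorials (`two_mul_pow_mul_inv_factorial_mem`). For
`p = 2` and `n` odd, `p^k/k! ∈ pO` suffices. -/

@[simp] lemma coeff_euler (n : ℕ) (f : F⟦X⟧) : coeff n (euler f) = (n : F) * coeff n f :=
  coeff_mk _ _

@[simp] lemma coeff_logInt (n : ℕ) (f : F⟦X⟧) : coeff n (logInt f) = coeff n f / (n : F) :=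
  coeff_mk _ _

lemma constantCoeff_logInt (f : F⟦X⟧) : constantCoeff (logInt f) = 0 := by
  rw [← coeff_zero_eq_constantCoeff_apply]; simp

lemma euler_eq_X_mul_derivative (f : F⟦X⟧) : euler f = X * d⁄dX F f := by
  ext n
  cases n with
  | zero => simp
  | succ n => rw [coeff_euler, coeff_succ_X_mul, coeff_derivative]; push_cast; ring

lemma euler_mul (f g : F⟦X⟧) : euler (f * g) = euler f * g + f * euler g := by
  simp only [euler_eq_X_mul_derivative, Derivation.leibniz, smul_eq_mul]; ring

lemma euler_add (f g : F⟦X⟧) : euler (f + g) = euler f + euler g := by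
  ext n; simp [mul_add]

lemma euler_sub (f g : F⟦X⟧) : euler (f - g) = euler f - euler g := by
  ext n; simp [mul_sub]

lemma euler_smul (a : F) (f : F⟦X⟧) : euler (a • f) = a • euler f := by
  ext n; simp [mul_left_comm]

lemma euler_neg (f : F⟦X⟧) : euler (-f) = -euler f := by
  ext n; simp

lemma coeff_pow_eq_zero {f : F⟦X⟧} (hf : constantCoeff f = 0) {n k : ℕ} (h : n < k) :
    coeff n (f ^ k) = 0 :=
  X_pow_dvd_iff.1 (pow_dvd_pow_of_dvd (X_dvd_iff.2 hf) k) n h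

variable [CharZero F]

lemma euler_logInt {f : F⟦X⟧} (hf : constantCoeff f = 0) : euler (logInt f) = f := by
  ext n
  rcases eq_or_ne n 0 with rfl | hn
  · simp [hf]
  · rw [coeff_euler, coeff_logInt, mul_div_cancel₀]; exact_mod_cast hn

lemma euler_injective {f g : F⟦X⟧} (h : euler f = euler g)
    (h0 : constantCoeff f = constantCoeff g) : f = g := by
  ext n
  rcases eq_or_ne n 0 with rfl | hn
  · simpa using h0
  · have := congrArg (coeff n) h
    rw [coeff_euler, coeff_euler] at this
    exact mul_left_cancel₀ (by exact_mod_cast hn) this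

/-- The exponential `exp(f)` of a power series `f` without constant term. -/
def expSeries (f : F⟦X⟧) : F⟦X⟧ := (PowerSeries.exp F).subst f

lemma euler_expSeries {f : F⟦X⟧} (hf : constantCoeff f = 0) :
    euler (expSeries f) = euler f * expSeries f := by
  rw [expSeries, euler_eq_X_mul_derivative, derivative_subst (HasSubst.of_constantCoeff_zero' hf),
    derivative_exp, euler_eq_X_mul_derivative]
  ring

lemma coeff_expSeries {f : F⟦X⟧} (hf : constantCoeff f = 0) (n : ℕ) :
    coeff n (expSeries f) = ∑ k ∈ Finset.range (n + 1), ((k ! : F)⁻¹) * coeff n (f ^ k) := by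
  rw [expSeries, coeff_subst' (HasSubst.of_constantCoeff_zero' hf)]
  rw [finsum_eq_sum_of_support_subset (s := Finset.range (n + 1))]
  · simp
  · intro k hk
    by_contra hkn
    refine hk ?_
    simp only [Finset.coe_range, Set.mem_Iio, not_lt] at hkn
    simp only [coeff_pow_eq_zero hf (show n < k by lia), smul_zero]

lemma constantCoeff_expSeries {f : F⟦X⟧} (hf : constantCoeff f = 0) :
    constantCoeff (expSeries f) = 1 := by
  rw [← coeff_zero_eq_constantCoeff_apply, coeff_expSeries hf]; simp

/-- Any solution of this equation is inverse to `exp(-f)`, because `δ` kills the product. All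
functional equations of `expSeries` below follow from this uniqueness. -/
lemma eq_expSeries {f E : F⟦X⟧} (hf : constantCoeff f = 0) (hE : constantCoeff E = 1)
    (h : euler E = euler f * E) : E = expSeries f := by
  have hf' : constantCoeff (-f) = 0 := by simp [hf]
  have key (E : F⟦X⟧) (hE : constantCoeff E = 1) (h : euler E = euler f * E) :
      E * expSeries (-f) = 1 := by
    refine euler_injective ?_ (by simp [hE, constantCoeff_expSeries hf'])
    rw [euler_mul, h, euler_expSeries hf', euler_neg]
    rw [euler_eq_X_mul_derivative 1, derivative_one]
    ring
  have h1 := key E hE h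
  have h2 := key _ (constantCoeff_expSeries hf) (euler_expSeries hf)
  refine mul_right_cancel₀ ?_ (h1.trans h2.symm)
  rintro h0
  rw [h0, mul_zero] at h1
  exact zero_ne_one h1

lemma expSeries_add {f g : F⟦X⟧} (hf : constantCoeff f = 0) (hg : constantCoeff g = 0) :
    expSeries (f + g) = expSeries f * expSeries g := by
  symm
  apply eq_expSeries
  · simp [hf, hg]
  · simp [constantCoeff_expSeries, hf, hg]
  · rw [euler_mul, euler_expSeries hf, euler_expSeries hg, euler_add]; ring

lemma expSeries_zero : expSeries (0 : F⟦X⟧) = 1 := by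
  symm
  apply eq_expSeries <;> simp [euler_eq_X_mul_derivative]

lemma expSeries_pow {f : F⟦X⟧} (hf : constantCoeff f = 0) (n : ℕ) :
    expSeries f ^ n = expSeries ((n : F) • f) := by
  induction n with
  | zero => simp [expSeries_zero]
  | succ n ih =>
    rw [pow_succ, ih, ← expSeries_add (by simp [hf]) hf]
    congr 1
    push_cast
    rw [add_smul, one_smul]

/-- With parameters `(ν, 0, 0, 0)` the Bell sum is the exponential series of `νn∫V` divided by `νn`,
and `νn · V exp(νn∫V) = δ exp(νn∫V)`. -/
lemma coeff_framingPlus {V : F⟦X⟧} (hV : constantCoeff V = 0) (ν : F) {n : ℕ} (hn : 0 < n) :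
    coeff n (framingPlus ν V) = coeff n (V * expSeries ((ν * n) • logInt V)) := by
  have hn0 : (n : F) ≠ 0 := by exact_mod_cast hn.ne'
  have hW := constantCoeff_logInt V
  have hgen : (genSeries fun j => ((j ! : F) * coeff j (logInt V)) / (j ! : F)) = logInt V := by
    ext j
    rw [genSeries, coeff_mk]
    split_ifs with hj
    · subst hj; simp
    · rw [mul_div_cancel_left₀]; exact_mod_cast j.factorial_ne_zero
  have hL : coeff n (framingPlus ν V) =
      n * ∑ k ∈ Finset.Icc 1 n, (ν * n) ^ (k - 1) * ((k ! : F)⁻¹ * coeff n (logInt V ^ k)) := by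
    have hf : (n ! : F) ≠ 0 := by exact_mod_cast n.factorial_ne_zero
    simp only [framingPlus, coeff_euler, genSeries, coeff_mk, if_neg hn.ne', bellTransform]
    congr 1
    rw [Finset.mul_sum]
    refine Finset.sum_congr rfl fun k _ => ?_
    rw [partialBell, hgen]
    simp only [zero_mul, add_zero, Finset.prod_const, Nat.card_Icc, coeff_smul, smul_eq_mul,
      Nat.add_sub_cancel]
    field_simp
  rw [hL]
  -- Division by `νn` is impossible when it is zero; then only `k = 1` survives, through `0 ^ 0 =
  -- 1`.
  rcases eq_or_ne (ν * n) 0 with h0 | h0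
  · rw [h0, zero_smul, expSeries_zero, mul_one, Finset.sum_eq_single 1]
    · simp [mul_div_cancel₀ _ hn0]
    · intro k hk hk1
      have : k - 1 ≠ 0 := by have := (Finset.mem_Icc.1 hk).1; lia
      simp [this]
    · intro h; exact absurd (Finset.mem_Icc.2 ⟨le_rfl, hn⟩) h
  · apply mul_left_cancel₀ h0
    have hcW : constantCoeff ((ν * n) • logInt V) = 0 := by simp [hW]
    have h1 : (ν * n) • (V * expSeries ((ν * n) • logInt V)) =
        euler (expSeries ((ν * n) • logInt V)) := by
      rw [euler_expSeries hcW, euler_smul, euler_logInt hV, smul_mul_assoc]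
    rw [← smul_eq_mul (ν * (n : F)) (coeff n _), ← coeff_smul, h1, coeff_euler,
      coeff_expSeries hcW, mul_left_comm]
    congr 1
    rw [Finset.range_eq_Ico, Finset.sum_eq_sum_Ico_succ_bot (Nat.succ_pos n), Finset.mul_sum]
    have : coeff n (((ν * (n : F)) • logInt V) ^ 0) = 0 := by simp [coeff_one, hn.ne']
    rw [this, mul_zero, zero_add]
    refine Finset.sum_congr (by ext; simp) fun k hk => ?_
    have hk1 : 1 ≤ k := (Finset.mem_Icc.1 hk).1
    obtain ⟨j, rfl⟩ := Nat.exists_eq_add_of_le' hk1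
    rw [smul_pow, coeff_smul, smul_eq_mul, Nat.add_sub_cancel, pow_succ (ν * (n : F))]
    ring

end FormalSeries

/-! ### Integral power series, Frobenius lifts and the Dieudonné–Dwork criterion. -/

section Integrality

variable {F : Type*} [Field F]

/-- The ring of power series with coefficients in the subring `O`. -/
def coeffSubring (O : Subring F) : Subring F⟦X⟧ := (PowerSeries.map O.subtype).range

lemma mem_coeffSubring {O : Subring F} {f : F⟦X⟧} :
    f ∈ coeffSubring O ↔ ∀ n, coeff n f ∈ O := by
  constructor
  · rintro ⟨g, rfl⟩ n
    simp
  · intro h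
    exact ⟨PowerSeries.mk fun n => ⟨coeff n f, h n⟩, by ext n; simp⟩

lemma C_mem_coeffSubring {O : Subring F} {a : F} (ha : a ∈ O) : C a ∈ coeffSubring O := by
  rw [mem_coeffSubring]
  intro n
  rw [coeff_C]
  split_ifs
  exacts [ha, O.zero_mem]

lemma X_mem_coeffSubring (O : Subring F) : (X : F⟦X⟧) ∈ coeffSubring O := by
  rw [mem_coeffSubring]
  intro n
  rw [coeff_X]
  split_ifs
  exacts [O.one_mem, O.zero_mem]

lemma euler_mem_coeffSubring {O : Subring F} {f : F⟦X⟧} (hf : f ∈ coeffSubring O) :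
    euler f ∈ coeffSubring O := by
  rw [mem_coeffSubring] at *
  intro n
  rw [coeff_euler]
  exact O.mul_mem (natCast_mem O n) (hf n)

/-- The lift `f ↦ σ(f)(z^p)` of the Frobenius to power series. -/
def frobLift (σ : F →+* F) (p : ℕ) (hp : p ≠ 0) : F⟦X⟧ →+* F⟦X⟧ :=
  (PowerSeries.expand p hp).toRingHom.comp (PowerSeries.map σ)

lemma coeff_frobLift (σ : F →+* F) (p : ℕ) (hp : p ≠ 0) (f : F⟦X⟧) (n : ℕ) :
    coeff n (frobLift σ p hp f) = if p ∣ n then σ (coeff (n / p) f) else 0 := by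
  simp [frobLift, coeff_expand]

lemma coeff_mul_frobLift (σ : F →+* F) (p : ℕ) (hp : p ≠ 0) (f : F⟦X⟧) (n : ℕ) :
    coeff (p * n) (frobLift σ p hp f) = σ (coeff n f) := by
  rw [coeff_frobLift, if_pos (dvd_mul_right p n), Nat.mul_div_cancel_left n (Nat.pos_of_ne_zero hp)]

lemma constantCoeff_frobLift (σ : F →+* F) (p : ℕ) (hp : p ≠ 0) (f : F⟦X⟧) :
    constantCoeff (frobLift σ p hp f) = σ (constantCoeff f) := by
  simpa using coeff_mul_frobLift σ p hp f 0

lemma frobLift_C (σ : F →+* F) (p : ℕ) (hp : p ≠ 0) (a : F) :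
    frobLift σ p hp (C a) = C (σ a) := by
  simp only [frobLift, RingHom.comp_apply, map_C]
  exact expand_C p hp (σ a)

lemma frobLift_X (σ : F →+* F) (p : ℕ) (hp : p ≠ 0) : frobLift σ p hp X = X ^ p := by
  simp [frobLift]

lemma euler_frobLift (σ : F →+* F) (p : ℕ) (hp : p ≠ 0) (f : F⟦X⟧) :
    euler (frobLift σ p hp f) = (p : F) • frobLift σ p hp (euler f) := by
  ext n
  rw [coeff_euler, coeff_smul, coeff_frobLift, coeff_frobLift]
  split_ifs with h
  · obtain ⟨m, rfl⟩ := h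
    rw [Nat.mul_div_cancel_left m (Nat.pos_of_ne_zero hp)]
    simp [mul_assoc]
  · simp

lemma frobLift_expSeries [CharZero F] (σ : F →+* F) (p : ℕ) (hp : p ≠ 0) {f : F⟦X⟧}
    (hf : constantCoeff f = 0) :
    frobLift σ p hp (expSeries f) = expSeries (frobLift σ p hp f) := by
  apply eq_expSeries
  · simp [constantCoeff_frobLift, hf]
  · simp [constantCoeff_frobLift, constantCoeff_expSeries hf]
  · rw [euler_frobLift, euler_frobLift, euler_expSeries hf, map_mul, smul_mul_assoc]

lemma frobLift_smul (σ : F →+* F) (p : ℕ) (hp : p ≠ 0) (a : F) (f : F⟦X⟧) :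
    frobLift σ p hp (a • f) = σ a • frobLift σ p hp f := by
  rw [smul_eq_C_mul, map_mul, frobLift_C, smul_eq_C_mul]

/-- On polynomials with coefficients in `O`, a Frobenius lift agrees with the `p`-th power map
modulo `p`. -/
lemma exists_frobLift_sub_pow {O : Subring F} {σ : F →+* F} {p : ℕ} (hp : p.Prime)
    (hσ : ∀ x ∈ O, ∃ y ∈ O, σ x - x ^ p = p * y) (t : Polynomial F) (ht : ∀ n, t.coeff n ∈ O) :
    ∃ g ∈ coeffSubring O, frobLift σ p hp.ne_zero (t : F⟦X⟧) - (t : F⟦X⟧) ^ p = C (p : F) * g := by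
  have hmon : ∀ n, ∀ a ∈ O, ∃ g ∈ coeffSubring O,
      frobLift σ p hp.ne_zero (C a * X ^ n) - (C a * X ^ n) ^ p = C (p : F) * g := by
    intro n a ha
    obtain ⟨y, hy, h⟩ := hσ a ha
    refine ⟨C y * (X ^ p) ^ n, Subring.mul_mem _ (C_mem_coeffSubring hy)
      (Subring.pow_mem _ (Subring.pow_mem _ (X_mem_coeffSubring O) _) _), ?_⟩
    rw [map_mul, map_pow, frobLift_C, frobLift_X, ← mul_assoc, ← map_mul, ← h]
    simp only [map_sub, map_pow]
    ring
  have hadd : ∀ f ∈ coeffSubring O, ∀ g ∈ coeffSubring O,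
      (∃ r ∈ coeffSubring O, frobLift σ p hp.ne_zero f - f ^ p = C (p : F) * r) →
      (∃ r ∈ coeffSubring O, frobLift σ p hp.ne_zero g - g ^ p = C (p : F) * r) →
      ∃ r ∈ coeffSubring O, frobLift σ p hp.ne_zero (f + g) - (f + g) ^ p = C (p : F) * r := by
    rintro f hf g hg ⟨r, hr, hfr⟩ ⟨s, hs, hgs⟩
    obtain ⟨q, hq⟩ := exists_add_pow_prime_eq hp (⟨f, hf⟩ : coeffSubring O) ⟨g, hg⟩
    have hq' : (f + g) ^ p = f ^ p + g ^ p + p * f * g * (q : F⟦X⟧) := congrArg Subtype.val hq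
    refine ⟨r + s - f * g * q, Subring.sub_mem _ (Subring.add_mem _ hr hs)
      (Subring.mul_mem _ (Subring.mul_mem _ hf hg) q.2), ?_⟩
    rw [hq', map_add, map_natCast]
    rw [map_natCast] at hfr hgs
    linear_combination hfr + hgs
  have hsum : ∀ s : Finset ℕ, (∑ n ∈ s, C (t.coeff n) * X ^ n : F⟦X⟧) ∈ coeffSubring O ∧
      ∃ r ∈ coeffSubring O, frobLift σ p hp.ne_zero (∑ n ∈ s, C (t.coeff n) * X ^ n) -
        (∑ n ∈ s, C (t.coeff n) * X ^ n) ^ p = C (p : F) * r := by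
    intro s
    induction s using Finset.induction_on with
    | empty => exact ⟨by simp, 0, Subring.zero_mem _, by simp [hp.ne_zero]⟩
    | insert a s has ih =>
      have hm : (C (t.coeff a) * X ^ a : F⟦X⟧) ∈ coeffSubring O :=
        Subring.mul_mem _ (C_mem_coeffSubring (ht a)) (Subring.pow_mem _ (X_mem_coeffSubring O) _)
      rw [Finset.sum_insert has]
      exact ⟨Subring.add_mem _ hm ih.1, hadd _ hm _ ih.1 (hmon a _ (ht a)) ih.2⟩
  have heq : (t : F⟦X⟧) = ∑ n ∈ t.support, C (t.coeff n) * X ^ n := by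
    ext n
    simp +contextual [coeff_C_mul, coeff_X_pow]
  rw [heq]
  exact (hsum t.support).2

/-- The Dieudonné–Dwork criterion. -/
lemma mem_coeffSubring_of_frobLift_eq {O : Subring F} {σ : F →+* F} {p : ℕ} (hp : p.Prime)
    (hp0 : (p : F) ≠ 0) (hσ : ∀ x ∈ O, ∃ y ∈ O, σ x - x ^ p = p * y) {f g : F⟦X⟧}
    (hf : constantCoeff f = 1) (hg : g ∈ coeffSubring O)
    (h : frobLift σ p hp.ne_zero f = f ^ p * (1 + C (p : F) * g)) : f ∈ coeffSubring O := by
  have hg0 : constantCoeff g = 0 := by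
    have := congrArg constantCoeff h
    simpa [constantCoeff_frobLift, hf, hp0] using this
  rw [mem_coeffSubring]
  intro m
  induction m using Nat.strong_induction_on with
  | _ m ih =>
    rcases Nat.eq_zero_or_pos m with rfl | hm
    · simp [hf, O.one_mem]
    -- Compare coefficients of degree `m` after replacing `f` by its truncation `t`, integral by
    -- induction: `frobLift f` does not see the change, and `f ^ p` changes by `p` times the unknown
    -- coefficient. As `frobLift t - t ^ p` is divisible by `p`, that factor cancels.
    set t : Polynomial F := trunc m f with ht
    have htc : ∀ n, t.coeff n ∈ O := by
      intro n
      rw [ht, coeff_trunc]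
      split_ifs with hn
      exacts [ih n hn, O.zero_mem]
    have htm : (t : F⟦X⟧) ∈ coeffSubring O := by
      rw [mem_coeffSubring]; intro n; rw [Polynomial.coeff_coe]; exact htc n
    obtain ⟨s, hs, hts⟩ := exists_frobLift_sub_pow hp hσ t htc
    obtain ⟨r, hr⟩ : X ^ m ∣ f - (t : F⟦X⟧) := by
      rw [X_pow_dvd_iff]
      intro n hn
      rw [map_sub, Polynomial.coeff_coe, ht, coeff_trunc, if_pos hn, sub_self]
    have ht0 : constantCoeff (t : F⟦X⟧) = 1 := by
      rw [← coeff_zero_eq_constantCoeff_apply, Polynomial.coeff_coe, ht, coeff_trunc, if_pos hm]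
      simpa using hf
    have hcm : ∀ q : F⟦X⟧, coeff m (X ^ m * q) = constantCoeff q := by
      intro q
      simpa using coeff_X_pow_mul q m 0
    have hr0 : constantCoeff r = coeff m f := by
      rw [← hcm, ← hr, map_sub, Polynomial.coeff_coe, ht, coeff_trunc, if_neg (lt_irrefl m),
        sub_zero]
    set G : F⟦X⟧ := ∑ i ∈ Finset.range p, f ^ i * (t : F⟦X⟧) ^ (p - 1 - i) with hG
    have hpow : f ^ p = (t : F⟦X⟧) ^ p + X ^ m * (r * G) := by
      have := geom_sum₂_mul f (t : F⟦X⟧) p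
      rw [hr, ← hG] at this
      linear_combination -this
    have hG0 : constantCoeff G = p := by simp [hG, hf, ht0]
    have h1 : coeff m (f ^ p) = coeff m ((t : F⟦X⟧) ^ p) + coeff m f * p := by
      rw [hpow, map_add, hcm, map_mul, hr0, hG0]
    have h2 : coeff m (f ^ p * g) = coeff m ((t : F⟦X⟧) ^ p * g) := by
      have : f ^ p * g = (t : F⟦X⟧) ^ p * g + X ^ m * (r * G * g) := by rw [hpow]; ring
      rw [this, map_add, hcm]
      simp [hg0]
    have h3 : coeff m (frobLift σ p hp.ne_zero f) =
        coeff m (frobLift σ p hp.ne_zero (t : F⟦X⟧)) := by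
      rw [coeff_frobLift, coeff_frobLift, Polynomial.coeff_coe, ht, coeff_trunc,
        if_pos (Nat.div_lt_self hm hp.one_lt)]
    have h4 := congrArg (coeff m) hts
    have h5 := congrArg (coeff m) h
    rw [map_sub, coeff_C_mul] at h4
    rw [show f ^ p * (1 + C (p : F) * g) = f ^ p + C (p : F) * (f ^ p * g) by ring, map_add,
      coeff_C_mul, h1, h2, h3] at h5
    have h6 : coeff m f = coeff m s - coeff m ((t : F⟦X⟧) ^ p * g) := by
      apply mul_left_cancel₀ hp0
      linear_combination h4 - h5
    rw [h6]
    exact O.sub_mem (mem_coeffSubring.1 hs m)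
      (mem_coeffSubring.1 (Subring.mul_mem _ (Subring.pow_mem _ htm _) hg) m)

variable [CharZero F]

lemma natCast_pow_mul_inv_factorial_mem {O : Subring F} {p : ℕ} (hp : p.Prime)
    (hO : ∀ d : ℕ, ¬ p ∣ d → ((d : F)⁻¹) ∈ O) {a k : ℕ} (h : padicValNat p k ! ≤ a) :
    (p : F) ^ a * ((k ! : F)⁻¹) ∈ O := by
  have : Fact p.Prime := ⟨hp⟩
  obtain ⟨m, hm⟩ := pow_padicValNat_dvd (p := p) (n := k !)
  have hpm : ¬ p ∣ m := by
    rintro ⟨l, rfl⟩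
    refine pow_succ_padicValNat_not_dvd (p := p) k.factorial_ne_zero ⟨l, ?_⟩
    rw [pow_succ, mul_assoc]; exact hm
  obtain ⟨b, rfl⟩ := Nat.exists_eq_add_of_le h
  have hp0 : (p : F) ≠ 0 := by exact_mod_cast hp.ne_zero
  have : (p : F) ^ (padicValNat p k ! + b) * ((k ! : F)⁻¹) = (p : F) ^ b * (m : F)⁻¹ := by
    have hk : (k ! : F) = (p : F) ^ padicValNat p k ! * m := by exact_mod_cast hm
    rw [hk, mul_inv, pow_add]
    field_simp
  rw [this]
  exact O.mul_mem (O.pow_mem (natCast_mem O p) _) (hO m hpm)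

/-- Legendre's formula: the left-hand product is `k` minus the base-`p` digit sum of `k`, which is
at least 1. -/
lemma sub_one_mul_padicValNat_factorial_lt {p k : ℕ} (hp : p.Prime) (hk : 0 < k) :
    (p - 1) * padicValNat p k ! + 1 ≤ k := by
  have : Fact p.Prime := ⟨hp⟩
  rw [sub_one_mul_padicValNat_factorial]
  have h1 : (p.digits k).sum ≠ 0 := by
    intro h0
    have hz : ∀ d ∈ p.digits k, d = 0 := fun d hd => by
      simpa using List.sum_eq_zero_iff.1 h0 d hd
    exact Nat.getLast_digit_ne_zero p hk.ne'
      (hz _ (List.getLast_mem (Nat.digits_ne_nil_iff_ne_zero.2 hk.ne')))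
  have h2 := Nat.digit_sum_le p k
  lia

lemma padicValNat_factorial_lt {p k : ℕ} (hp : p.Prime) (hk : 0 < k) :
    padicValNat p k ! + 1 ≤ k := by
  have h := sub_one_mul_padicValNat_factorial_lt hp hk
  have : 1 * padicValNat p k ! ≤ (p - 1) * padicValNat p k ! :=
    Nat.mul_le_mul_right _ (by have := hp.two_le; lia)
  lia

lemma pow_mul_inv_factorial_mem {O : Subring F} {p : ℕ} (hp : p.Prime)
    (hO : ∀ d : ℕ, ¬ p ∣ d → ((d : F)⁻¹) ∈ O) {k : ℕ} (hk : 0 < k) :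
    ∃ y ∈ O, (p : F) ^ k * ((k ! : F)⁻¹) = p * y := by
  obtain ⟨j, rfl⟩ := Nat.exists_eq_add_of_le' hk
  exact ⟨_, natCast_pow_mul_inv_factorial_mem hp hO
    (show padicValNat p (j + 1)! ≤ j by have := padicValNat_factorial_lt hp hk; lia),
    by rw [pow_succ]; ring⟩

lemma exists_expSeries_eq {O : Subring F} {p : ℕ} (hp : p.Prime)
    (hO : ∀ d : ℕ, ¬ p ∣ d → ((d : F)⁻¹) ∈ O) {f : F⟦X⟧} (hf : f ∈ coeffSubring O)
    (hf0 : constantCoeff f = 0) :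
    ∃ g ∈ coeffSubring O, expSeries ((p : F) • f) = 1 + C (p : F) * g := by
  choose y hy hpy using fun k : {k : ℕ // 0 < k} => pow_mul_inv_factorial_mem hp hO k.2
  refine ⟨PowerSeries.mk fun n => ∑ k ∈ Finset.range n, y ⟨k + 1, k.succ_pos⟩ *
    coeff n (f ^ (k + 1)), ?_, ?_⟩
  · rw [mem_coeffSubring]
    intro n
    rw [coeff_mk]
    exact O.sum_mem fun k _ => O.mul_mem (hy _) (mem_coeffSubring.1 (Subring.pow_mem _ hf _) n)
  · ext n
    rw [coeff_expSeries (by simp [hf0]), Finset.sum_range_succ', add_comm, map_add, coeff_C_mul,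
      coeff_mk, Finset.mul_sum]
    congr 1
    · simp
    · refine Finset.sum_congr rfl fun k _ => ?_
      have := hpy ⟨k + 1, k.succ_pos⟩
      rw [smul_pow, coeff_smul, smul_eq_mul, ← mul_assoc, ← mul_assoc, ← this, mul_comm (_⁻¹)]

end Integrality

/-! ### The congruences over a subring with a Frobenius lift. -/

section LocalCongruence

variable {F : Type*} [Field F] [CharZero F]

lemma coeff_mul_expSeries (E : F⟦X⟧) {f : F⟦X⟧} (hf : constantCoeff f = 0) (N : ℕ) :
    coeff N (E * expSeries f) =
      ∑ k ∈ Finset.range (N + 1), ((k ! : F)⁻¹) * coeff N (f ^ k * E) := by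
  obtain ⟨r, hr⟩ : X ^ (N + 1) ∣ expSeries f -
      ∑ k ∈ Finset.range (N + 1), ((k ! : F)⁻¹) • f ^ k := by
    rw [X_pow_dvd_iff]
    intro n hn
    rw [map_sub, coeff_expSeries hf, map_sum, sub_eq_zero]
    simp only [coeff_smul, smul_eq_mul]
    refine Finset.sum_subset (Finset.range_mono hn) fun k _ hk => ?_
    rw [coeff_pow_eq_zero hf (by simpa using hk), mul_zero]
  rw [sub_eq_iff_eq_add.1 hr, mul_add, map_add,
    show E * (X ^ (N + 1) * r) = X ^ (N + 1) * (E * r) by ring, coeff_X_pow_mul',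
    if_neg (by lia), zero_add, Finset.mul_sum, map_sum]
  refine Finset.sum_congr rfl fun k _ => ?_
  rw [mul_smul_comm, coeff_smul, smul_eq_mul, mul_comm E]

/-- The Taylor expansion of the difference of the `N`-th coefficients of `U exp(c∫U)` and
`V exp(c∫V)`, where `∫U = W + H` and `∫V = W`. -/
lemma coeff_sub_eq_sum {U V W H : F⟦X⟧} (hW : constantCoeff W = 0) (hH : constantCoeff H = 0)
    (hWV : euler W = V) (hHU : euler H = U - V) (c : F) {N : ℕ} (hN : 0 < N) :
    coeff N (U * (expSeries (c • W) * expSeries (c • H))) - coeff N (V * expSeries (c • W)) =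
      N * ∑ k ∈ Finset.range N, c ^ k * (((k + 1)! : F)⁻¹) *
        coeff N (H ^ (k + 1) * expSeries (c • W)) := by
  rcases eq_or_ne c 0 with rfl | hc
  · obtain ⟨M, rfl⟩ := Nat.exists_eq_add_of_le' hN
    rw [Finset.sum_range_succ']
    simp only [zero_smul, expSeries_zero, mul_one, ← map_sub, ← hHU, coeff_euler]
    simp
  · apply mul_left_cancel₀ hc
    have hcW : constantCoeff (c • W) = 0 := by simp [hW]
    have hcH : constantCoeff (c • H) = 0 := by simp [hH]
    -- The difference, times `c`, is a `δ`-derivative; this produces the factor `N`.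
    have h1 : c • (U * (expSeries (c • W) * expSeries (c • H)) - V * expSeries (c • W)) =
        euler (expSeries (c • W) * expSeries (c • H) - expSeries (c • W)) := by
      rw [euler_sub, euler_mul, euler_expSeries hcW, euler_expSeries hcH, euler_smul, euler_smul,
        hWV, hHU]
      simp only [smul_eq_C_mul]
      ring
    rw [← map_sub, ← smul_eq_mul c (coeff N _), ← coeff_smul, h1, coeff_euler, map_sub,
      coeff_mul_expSeries _ hcH, Finset.sum_range_succ', mul_left_comm]
    congr 1
    simp only [Nat.factorial_zero, Nat.cast_one, inv_one, pow_zero, one_mul, add_sub_cancel_right]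
    rw [Finset.mul_sum]
    refine Finset.sum_congr rfl fun k _ => ?_
    rw [smul_pow, smul_mul_assoc, coeff_smul, smul_eq_mul]
    ring

/-- Integration by parts in the first two terms of the Taylor expansion. -/
lemma exists_quadratic_term_eq {O : Subring F} {V G E : F⟦X⟧} {ν : F} {N : ℕ} (hN : 0 < N)
    (hν : ν ∈ O) (hV : V ∈ coeffSubring O) (hG : G ∈ coeffSubring O) (hE : E ∈ coeffSubring O)
    (hEV : euler E = C (ν * N) * (V * E)) :
    ∃ y ∈ O, 2 / (N : F) * coeff N (euler (euler G) * E) +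
        ν * coeff N (euler (euler G) ^ 2 * E) -
        ν * coeff N (euler (2 * V + euler (euler (euler G))) * E * G) = N * y := by
  have hN0 : (N : F) ≠ 0 := by exact_mod_cast hN.ne'
  set G₁ := euler G with hG₁
  set H := euler G₁ with hH
  set H₁ := euler H with hH₁
  have mG₁ : G₁ ∈ coeffSubring O := euler_mem_coeffSubring hG
  have mH : H ∈ coeffSubring O := euler_mem_coeffSubring mG₁
  have mH₁ : H₁ ∈ coeffSubring O := euler_mem_coeffSubring mH
  -- Since `[δf]_N = N[f]_N` and `δE = νNVE`, moving a `δ` off `G` costs only multiples of `N`,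
  -- besides the derivatives of the other factors. `e1`–`e3` reduce `2/N · [HE]` to `2ν[δV·E·G]`
  -- modulo `N`.
  have e1 : coeff N (H * E) = N * coeff N (G₁ * E) - ν * N * coeff N (G₁ * V * E) := by
    have : H * E = euler (G₁ * E) - C (ν * N) * (G₁ * V * E) := by
      rw [euler_mul, hEV, ← hH]; ring
    rw [this, map_sub, coeff_euler, coeff_C_mul]
  have e2 : coeff N (G₁ * E) = N * coeff N (G * E) - ν * N * coeff N (G * V * E) := by
    have : G₁ * E = euler (G * E) - C (ν * N) * (G * V * E) := by
      rw [euler_mul, hEV, ← hG₁]; ring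
    rw [this, map_sub, coeff_euler, coeff_C_mul]
  have e3 : coeff N (G₁ * V * E) = N * coeff N (G * V * E) - coeff N (euler V * E * G) -
      ν * N * coeff N (G * V ^ 2 * E) := by
    have : G₁ * V * E = euler (G * V * E) - euler V * E * G - C (ν * N) * (G * V ^ 2 * E) := by
      rw [euler_mul, euler_mul, hEV, ← hG₁]; ring
    rw [this, map_sub, map_sub, coeff_euler, coeff_C_mul]
  -- Two integrations by parts move both `δ`'s of one factor `H = δ²G` onto the other.
  have e4 : coeff N (H ^ 2 * E) = coeff N (euler H₁ * E * G) - N * coeff N (H₁ * E * G)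
      + ν * N * coeff N (H₁ * V * E * G) + N * coeff N (H * E * G₁)
      - ν * N * coeff N (H * V * E * G₁) := by
    have : H ^ 2 * E = euler H₁ * E * G - euler (H₁ * E * G) + C (ν * N) * (H₁ * V * E * G)
        + euler (H * E * G₁) - C (ν * N) * (H * V * E * G₁) := by
      simp only [euler_mul, hEV, ← hG₁, ← hH, ← hH₁]; ring
    rw [this]
    simp only [map_sub, map_add, coeff_euler, coeff_C_mul]
  have e5 : coeff N (euler (2 * V + H₁) * E * G) =
      2 * coeff N (euler V * E * G) + coeff N (euler H₁ * E * G) := by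
    have : euler (2 * V + H₁) * E * G = euler V * E * G + euler V * E * G + euler H₁ * E * G := by
      rw [two_mul, euler_add, euler_add]; ring
    rw [this]
    simp only [map_add]
    ring
  have hc : ∀ f ∈ coeffSubring O, coeff N f ∈ O := fun f hf => mem_coeffSubring.1 hf N
  refine ⟨2 * (coeff N (G * E) - 2 * ν * coeff N (G * V * E) + ν ^ 2 * coeff N (G * V ^ 2 * E))
    - ν * (coeff N (H₁ * E * G) - ν * coeff N (H₁ * V * E * G) - coeff N (H * E * G₁)
      + ν * coeff N (H * V * E * G₁)), ?_, ?_⟩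
  · have m2 : (2 : F) ∈ O := ofNat_mem O 2
    have m1 := hc _ (mul_mem hG hE)
    have m3 := hc _ (mul_mem (mul_mem hG hV) hE)
    have m4 := hc _ (mul_mem (mul_mem hG (pow_mem hV 2)) hE)
    have m5 := hc _ (mul_mem (mul_mem mH₁ hE) hG)
    have m6 := hc _ (mul_mem (mul_mem (mul_mem mH₁ hV) hE) hG)
    have m7 := hc _ (mul_mem (mul_mem mH hE) mG₁)
    have m8 := hc _ (mul_mem (mul_mem (mul_mem mH hV) hE) mG₁)
    exact sub_mem (mul_mem m2 (add_mem (sub_mem m1 (mul_mem (mul_mem m2 hν) m3))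
      (mul_mem (pow_mem hν 2) m4))) (mul_mem hν (add_mem (sub_mem (sub_mem m5 (mul_mem hν m6)) m7)
      (mul_mem hν m8)))
  · rw [e5, e4, e1, e2, e3]
    field_simp
    ring

/-- `exp(ν∫V)` is integral if `V` is a `1`-function. -/
lemma expSeries_smul_mem {O : Subring F} {σ : F →+* F} {p : ℕ} (hp : p.Prime)
    (hO : ∀ d : ℕ, ¬ p ∣ d → ((d : F)⁻¹) ∈ O) (hσ : ∀ x ∈ O, ∃ y ∈ O, σ x - x ^ p = p * y)
    {W H : F⟦X⟧} (hW : constantCoeff W = 0) (hH : constantCoeff H = 0) (hHO : H ∈ coeffSubring O)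
    (hWH : frobLift σ p hp.ne_zero W = (p : F) • (W + H)) {ν : F} (hν : ν ∈ O) (hσν : σ ν = ν) :
    expSeries (ν • W) ∈ coeffSubring O := by
  have hνH : ν • H ∈ coeffSubring O := by
    rw [smul_eq_C_mul]; exact mul_mem (C_mem_coeffSubring hν) hHO
  obtain ⟨g, hg, hge⟩ := exists_expSeries_eq hp hO hνH (by simp [hH])
  have hνW : constantCoeff (ν • W) = 0 := by simp [hW]
  refine mem_coeffSubring_of_frobLift_eq hp (by exact_mod_cast hp.ne_zero) hσ
    (constantCoeff_expSeries hνW) hg ?_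
  -- The lift of `exp(νW)` is `exp(νW)^p · exp(pνH)`, and the second factor is 1 modulo `p`.
  rw [frobLift_expSeries σ p hp.ne_zero hνW, ← hge, expSeries_pow hνW,
    ← expSeries_add (by simp [hW]) (by simp [hH]), frobLift_smul, hσν, hWH]
  congr 1
  simp only [smul_add, smul_comm ν (p : F)]

/-- Bounds the Taylor tail. Legendre gives `v_p((k+3)!) ≤ (k+2)/(p-1)`, which is at most `k` for `p
≥ 5` (by integrality when `k = 0, 1`) and at most `k + 1` for `p = 3`. For `p = 2`, `4 ∣ N` and the
extra 2 supply `2k + 1`. -/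
lemma two_mul_pow_mul_inv_factorial_mem {O : Subring F} {p : ℕ} (hp : p.Prime)
    (hO : ∀ d : ℕ, ¬ p ∣ d → ((d : F)⁻¹) ∈ O) {N : ℕ} (hpN : p ∣ N) (h2 : p = 2 → 4 ∣ N) (k : ℕ) :
    (p : F) ^ (if p = 3 then 1 else 0) * 2 * N ^ k * (((k + 3)! : F)⁻¹) ∈ O := by
  have hv := sub_one_mul_padicValNat_factorial_lt hp (Nat.succ_pos (k + 2))
  have of_le : ∀ a, padicValNat p (k + 3)! ≤ a → (p : F) ^ a * (((k + 3)! : F)⁻¹) ∈ O :=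
    fun a => natCast_pow_mul_inv_factorial_mem hp hO
  by_cases hp2 : p = 2
  · subst hp2
    obtain ⟨m, rfl⟩ := h2 rfl
    have h6 : padicValNat 2 (k + 3)! ≤ 2 * k + 1 := by
      -- At `k = 0` the Legendre bound is 2, one too many; the exact valuation of `3!` is needed.
      rcases Nat.eq_zero_or_pos k with rfl | hk
      · have := sub_one_mul_padicValNat_factorial (p := 2) 3
        norm_num at this
        simpa [Nat.factorial] using this.le
      · lia
    have := O.mul_mem (of_le _ h6) (O.pow_mem (natCast_mem O m) k)
    convert this using 1
    rw [if_neg (by norm_num), pow_zero, one_mul, pow_succ, pow_mul]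
    push_cast
    ring
  · obtain ⟨m, rfl⟩ := hpN
    have h6 : padicValNat p (k + 3)! ≤ (if p = 3 then 1 else 0) + k := by
      split_ifs with h3
      · subst h3; lia
      · have h5 : 5 ≤ p := by
          have := hp.two_le
          have h4 : p ≠ 4 := by rintro rfl; exact absurd hp (by norm_num)
          lia
        have : 4 * padicValNat p (k + 3)! ≤ (p - 1) * padicValNat p (k + 3)! :=
          Nat.mul_le_mul_right _ (by lia)
        lia
    have := O.mul_mem (O.mul_mem (ofNat_mem O 2) (of_le _ h6)) (O.pow_mem (natCast_mem O m) k)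
    convert this using 1
    rw [pow_add]
    push_cast
    ring

/-- The congruences for the framed coefficients over a subring `O` with a Frobenius lift. -/
theorem framing_congruences {O : Subring F} {σ : F →+* F} {p : ℕ} (hp : p.Prime)
    (hO : ∀ d : ℕ, ¬ p ∣ d → ((d : F)⁻¹) ∈ O) (hσ : ∀ x ∈ O, ∃ y ∈ O, σ x - x ^ p = p * y)
    {V : F⟦X⟧} (hV0 : constantCoeff V = 0) (hV : V ∈ coeffSubring O)
    (hG : logInt (logInt (logInt (frobLift σ p hp.ne_zero V - V))) ∈ coeffSubring O)
    {ν : F} (hν : ν ∈ O) (hσν : σ ν = ν) {n : ℕ} (hn : 0 < n) :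
    (∃ y ∈ O, σ (coeff n (framingPlus ν V)) - coeff (p * n) (framingPlus ν V) = p * y) ∧
    ((p = 2 → 2 ∣ n) → ∃ y ∈ O, (p : F) ^ (if p = 3 then 1 else 0) *
      (2 / ((p : F) ^ 2 * (n : F) ^ 2) *
        (σ (coeff n (framingPlus ν V)) - coeff (p * n) (framingPlus ν V)) -
      ν * coeff (p * n) (euler (frobLift σ p hp.ne_zero V + V) *
        expSeries (ν • logInt V) ^ (p * n) *
        logInt (logInt (logInt (frobLift σ p hp.ne_zero V - V))))) = (p * n : ℕ) * y) := by
  set U := frobLift σ p hp.ne_zero V with hU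
  set G := logInt (logInt (logInt (U - V))) with hGdef
  set W := logInt V with hWdef
  set N := p * n with hNdef
  set H := euler (euler G) with hHdef
  have hN : 0 < N := Nat.mul_pos hp.pos hn
  have hN0 : (N : F) ≠ 0 := by exact_mod_cast hN.ne'
  have hNc : (N : F) = p * n := by push_cast [hNdef]; ring
  have hUV0 : constantCoeff (U - V) = 0 := by simp [hU, constantCoeff_frobLift, hV0]
  have hHlog : H = logInt (U - V) := by
    rw [hHdef, hGdef, euler_logInt (constantCoeff_logInt _), euler_logInt (constantCoeff_logInt _)]
  have hW : constantCoeff W = 0 := constantCoeff_logInt _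
  have hH : constantCoeff H = 0 := hHlog ▸ constantCoeff_logInt _
  have hWV : euler W = V := euler_logInt hV0
  have hHU : euler H = U - V := by rw [hHlog, euler_logInt hUV0]
  have hHO : H ∈ coeffSubring O := euler_mem_coeffSubring (euler_mem_coeffSubring hG)
  have hWH : frobLift σ p hp.ne_zero W = (p : F) • (W + H) := by
    apply euler_injective
    · rw [euler_frobLift, euler_smul, euler_add, hWV, hHU, add_sub_cancel]
    · simp [constantCoeff_frobLift, hW, hH]
  set E := expSeries ((ν * N) • W) with hEdef
  have hcW : constantCoeff (ν • W) = 0 := by simp [hW]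
  have hEpow : expSeries (ν • W) ^ N = E := by
    rw [expSeries_pow hcW, smul_smul, mul_comm]
  have hE : E ∈ coeffSubring O := by
    rw [← hEpow]
    exact pow_mem (expSeries_smul_mem hp hO hσ hW hH hHO hWH hν hσν) N
  have hEV : euler E = C (ν * N) * (V * E) := by
    rw [hEdef, euler_expSeries (by simp [hW]), euler_smul, hWV, smul_eq_C_mul, mul_assoc]
  -- `σ` of an `n`-th coefficient is the `pn`-th coefficient of the lifted series, so both terms
  -- become `N`-th coefficients.
  have hΔ : σ (coeff n (framingPlus ν V)) - coeff N (framingPlus ν V) =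
      N * ∑ k ∈ Finset.range N, (ν * N) ^ k * (((k + 1)! : F)⁻¹) * coeff N (H ^ (k + 1) * E) := by
    rw [hEdef, ← coeff_sub_eq_sum hW hH hWV hHU (ν * N) hN, coeff_framingPlus hV0 ν hn,
      coeff_framingPlus hV0 ν hN, ← coeff_mul_frobLift σ p hp.ne_zero,
      map_mul (frobLift σ p hp.ne_zero), ← hU, ← hWdef,
      frobLift_expSeries σ p hp.ne_zero (by simp [hW]), frobLift_smul, hWH,
      ← expSeries_add (by simp [hW]) (by simp [hH]), map_mul σ, hσν, map_natCast, smul_smul,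
      smul_add, hNc, show ν * (n : F) * p = ν * (p * n) by ring]
  have hHE : ∀ k, coeff N (H ^ k * E) ∈ O := fun k =>
    mem_coeffSubring.1 (mul_mem (pow_mem hHO k) hE) N
  rw [hΔ]
  constructor
  · choose y hy hpy using fun k : ℕ => pow_mul_inv_factorial_mem hp hO (Nat.succ_pos k)
    refine ⟨∑ k ∈ Finset.range N, ν ^ k * n ^ (k + 1) * y k * coeff N (H ^ (k + 1) * E), ?_, ?_⟩
    · exact sum_mem fun k _ => mul_mem (mul_mem (mul_mem (pow_mem hν k)
        (pow_mem (natCast_mem O n) _)) (hy k)) (hHE _)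
    · rw [Finset.mul_sum, Finset.mul_sum]
      refine Finset.sum_congr rfl fun k _ => ?_
      have h := hpy k
      rw [Nat.succ_eq_add_one] at h
      rw [hNc]
      linear_combination (ν ^ k * n ^ (k + 1) * coeff N (H ^ (k + 1) * E)) * h
  · intro h2
    obtain ⟨y, hy, hye⟩ := exists_quadratic_term_eq hN hν hV hG hE hEV
    have hUV : 2 * V + euler (euler (euler G)) = U + V := by rw [← hHdef, hHU]; ring
    rw [← hHdef, hUV] at hye
    -- For `p = 2` the evenness of `n` enters only here.
    have h24 : p = 2 → 4 ∣ N := by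
      rintro rfl
      exact Nat.mul_dvd_mul_left 2 (h2 rfl)
    have hz := two_mul_pow_mul_inv_factorial_mem hp hO (dvd_mul_right p n) h24
    obtain ⟨M, hM⟩ : ∃ M, N = M + 2 := Nat.exists_eq_add_of_le'
      (hp.two_le.trans (Nat.le_of_dvd hN (dvd_mul_right p n)))
    have hsplit : ∑ k ∈ Finset.range N, (ν * N) ^ k * (((k + 1)! : F)⁻¹) *
        coeff N (H ^ (k + 1) * E) = coeff N (H * E) + ν * N / 2 * coeff N (H ^ 2 * E) +
        ∑ k ∈ Finset.range M, (ν * N) ^ (k + 2) * (((k + 3)! : F)⁻¹) *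
          coeff N (H ^ (k + 3) * E) := by
      conv_lhs => rw [show Finset.range N = Finset.range (M + 2) by rw [hM]]
      rw [Finset.sum_range_succ', Finset.sum_range_succ']
      simp
      ring
    rw [hsplit, hEpow]
    refine ⟨(p : F) ^ (if p = 3 then 1 else 0) * y + ∑ k ∈ Finset.range M, ν ^ (k + 2) *
      ((p : F) ^ (if p = 3 then 1 else 0) * 2 * N ^ k * (((k + 3)! : F)⁻¹)) *
        coeff N (H ^ (k + 3) * E), ?_, ?_⟩
    · exact add_mem (mul_mem (pow_mem (natCast_mem O p) _) hy) (sum_mem fun k _ =>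
        mul_mem (mul_mem (pow_mem hν _) (hz k)) (hHE _))
    · have hsum : ∑ k ∈ Finset.range M, ν ^ (k + 2) *
          ((p : F) ^ (if p = 3 then 1 else 0) * 2 * N ^ k * (((k + 3)! : F)⁻¹)) *
            coeff N (H ^ (k + 3) * E) = (p : F) ^ (if p = 3 then 1 else 0) * 2 / N ^ 2 *
          ∑ k ∈ Finset.range M, (ν * N) ^ (k + 2) * (((k + 3)! : F)⁻¹) *
            coeff N (H ^ (k + 3) * E) := by
        rw [Finset.mul_sum]
        refine Finset.sum_congr rfl fun k _ => ?_
        field_simp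
        ring
      have hS : ∀ A B S : F, 2 / (N : F) ^ 2 * (N * (A + ν * N / 2 * B + S)) =
          2 / N * A + ν * B + N * (2 / N ^ 2 * S) := by
        intro A B S
        field_simp
      rw [hsum, ← mul_pow, ← hNc, hS]
      linear_combination (p : F) ^ (if p = 3 then 1 else 0) * hye

end LocalCongruence

/-! ### Local integrality and Frobenius at an unramified place of `K`. -/

section NumberFieldPlaces

variable {K : Type*} [Field K] [NumberField K]

lemma valued_algebraMap (v : HeightOneSpectrum (𝓞 K)) (x : K) :
    Valued.v (algebraMap K (v.adicCompletion K) x) = v.valuation K x :=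
  HeightOneSpectrum.valuedAdicCompletion_eq_valuation' v x

lemma isLocInt_iff {v : HeightOneSpectrum (𝓞 K)} {x : K} :
    IsLocInt v x ↔ x ∈ (v.valuation K).integer := by
  rw [IsLocInt, HeightOneSpectrum.mem_adicCompletionIntegers, valued_algebraMap]
  rfl

lemma locCongr_of_eq {v : HeightOneSpectrum (𝓞 K)} {p e : ℕ} {x y c : K}
    (hc : c ∈ (v.valuation K).integer) (h : x - y = (p : K) ^ e * c) : LocCongr v p e x y :=
  ⟨algebraMap K _ c, isLocInt_iff.2 hc, by rw [h]; simp⟩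

/-- The witness in the completion is a quotient of elements of `K`, so the valuation ring of `K` can
replace `𝓞_v`. -/
lemma exists_eq_of_locCongr {v : HeightOneSpectrum (𝓞 K)} {p e : ℕ} (hp : p ≠ 0) {x y : K}
    (h : LocCongr v p e x y) : ∃ c ∈ (v.valuation K).integer, x - y = (p : K) ^ e * c := by
  obtain ⟨c, hc, h⟩ := h
  have hp0 : (p : K) ^ e ≠ 0 := pow_ne_zero _ (by exact_mod_cast hp)
  have hc' : algebraMap K (v.adicCompletion K) ((x - y) / (p : K) ^ e) = c := by
    have hp1 : algebraMap K (v.adicCompletion K) ((p : K) ^ e) ≠ 0 :=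
      (map_ne_zero (algebraMap K (v.adicCompletion K))).2 hp0
    rw [map_div₀, h, div_eq_iff hp1]
    simp [mul_comm]
  exact ⟨(x - y) / (p : K) ^ e, isLocInt_iff.1 (by rw [IsLocInt, hc']; exact hc),
    by field_simp⟩

lemma natCast_inv_mem_integer {v : HeightOneSpectrum (𝓞 K)} {p : ℕ} (hp : p.Prime)
    (hv : (p : 𝓞 K) ∈ v.asIdeal) (d : ℕ) (hd : ¬ p ∣ d) :
    ((d : K)⁻¹) ∈ (v.valuation K).integer := by
  have h : (d : 𝓞 K) ∉ v.asIdeal := by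
    intro hdv
    have hco : IsCoprime (p : ℤ) (d : ℤ) :=
      Nat.isCoprime_iff_coprime.2 ((hp.coprime_iff_not_dvd).2 hd)
    obtain ⟨a, b, hab⟩ := hco
    refine v.isPrime.ne_top ((Ideal.eq_top_iff_one _).2 ?_)
    have h1 : (1 : 𝓞 K) = a * p + b * d := by exact_mod_cast hab.symm
    rw [h1]
    exact add_mem (Ideal.mul_mem_left _ _ hv) (Ideal.mul_mem_left _ _ hdv)
  have h1 : v.valuation K (d : K) = 1 := by
    have := (HeightOneSpectrum.valuation_eq_one_iff_notMem (K := K) v).2 h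
    simpa using this
  rw [Valuation.mem_integer_iff, map_inv₀, h1, inv_one]

omit [NumberField K] in
lemma liesOver_span {v : HeightOneSpectrum (𝓞 K)} {p : ℕ} (hp : p.Prime)
    (hv : (p : 𝓞 K) ∈ v.asIdeal) : v.asIdeal.LiesOver (Ideal.span {(p : ℤ)}) :=
  (Ideal.liesOver_span_iff v.isPrime.ne_top (Nat.prime_iff_prime_int.1 hp)).2 (by simpa using hv)

lemma natCast_notMem_sq {v : HeightOneSpectrum (𝓞 K)} {p : ℕ} (hp : p.Prime)
    (hunr : UnramifiedPrime K p) (hv : (p : 𝓞 K) ∈ v.asIdeal) : (p : 𝓞 K) ∉ v.asIdeal ^ 2 := by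
  intro h
  have hover := liesOver_span hp hv
  have := v.isPrime
  have hspan : Ideal.span {(p : ℤ)} ≠ ⊥ := by simpa using hp.ne_zero
  have h1 := hunr.ramificationIdx_eq_one (𝔓 := v.asIdeal) hover
  rw [← Ideal.ramificationIdx'_eq_ramificationIdx _ _ hspan] at h1
  refine (Ideal.ramificationIdx'_ne_one_iff ?_).2 ?_ h1 <;>
    rw [Ideal.map_span, Set.image_singleton, Ideal.span_singleton_le_iff_mem] <;> simpa using ‹_›

/-- Unramifiedness makes `p` a uniformizer at `v`. -/
lemma exists_eq_natCast_mul {v : HeightOneSpectrum (𝓞 K)} {p : ℕ} (hp : p.Prime)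
    (hunr : UnramifiedPrime K p) (hv : (p : 𝓞 K) ∈ v.asIdeal) {x : K}
    (hx : v.valuation K x < 1) : ∃ y ∈ (v.valuation K).integer, x = p * y := by
  have hp0 : (p : K) ≠ 0 := by exact_mod_cast hp.ne_zero
  refine ⟨x / p, ?_, by field_simp⟩
  have h1 : WithZero.exp (-1 : ℤ) ≤ v.valuation K (p : K) := by
    by_contra! h
    refine natCast_notMem_sq hp hunr hv ?_
    rw [← HeightOneSpectrum.intValuation_le_pow_iff_mem]
    refine (HeightOneSpectrum.valuation_of_algebraMap (K := K) v _).symm.trans_le ?_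
    change v.valuation K (algebraMap (𝓞 K) K (p : 𝓞 K)) ≤ _
    rw [map_natCast (algebraMap (𝓞 K) K),
      ← WithZero.lt_mul_exp_iff_le WithZero.exp_ne_zero, ← WithZero.exp_add]
    simpa using h
  have h3 : v.valuation K x ≤ WithZero.exp (-1 : ℤ) := by
    rw [← WithZero.lt_mul_exp_iff_le WithZero.exp_ne_zero, ← WithZero.exp_add]
    simpa using hx
  rw [Valuation.mem_integer_iff, map_div₀]
  exact div_le_one_of_le₀ (h3.trans h1) zero_le

lemma ratCast_mem_integer {v : HeightOneSpectrum (𝓞 K)} {p : ℕ} (hp : p.Prime)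
    (hunr : UnramifiedPrime K p) (hv : (p : 𝓞 K) ∈ v.asIdeal) {ν : ℚ}
    (hν : ν ∈ Algebra.adjoin ℤ {((NumberField.discr K : ℚ))⁻¹}) :
    (ν : K) ∈ (v.valuation K).integer := by
  induction hν using Algebra.adjoin_induction with
  | mem x hx =>
    rw [Set.mem_singleton_iff] at hx
    subst hx
    have hD : ¬ (p : ℤ) ∣ NumberField.discr K :=
      (NumberField.not_dvd_discr_iff_isUnramifiedIn K (𝓞 K) (Nat.prime_iff_prime_int.1 hp)).2 hunr
    have := natCast_inv_mem_integer hp hv (NumberField.discr K).natAbs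
      (by rwa [← Int.natCast_dvd])
    rw [Nat.cast_natAbs] at this
    push_cast
    rcases abs_choice (NumberField.discr K) with h | h <;> rw [h] at this
    · exact this
    · push_cast at this
      rw [inv_neg] at this
      exact neg_mem_iff.1 this
  | algebraMap r => simp
  | add x y _ _ hx hy => push_cast; exact add_mem hx hy
  | mul x y _ _ hx hy => push_cast; exact mul_mem hx hy

variable [IsGalois ℚ K]

lemma frob_sub_pow_mem {v : HeightOneSpectrum (𝓞 K)} {p : ℕ} (hp : p.Prime)
    (hv : (p : 𝓞 K) ∈ v.asIdeal) (x : 𝓞 K) : frob v • x - x ^ p ∈ v.asIdeal := by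
  have := v.isPrime
  have : Finite (𝓞 K ⧸ v.asIdeal) := inferInstance
  have h := IsArithFrobAt.arithFrobAt ℤ Gal(K/ℚ) v.asIdeal x
  have hover := liesOver_span hp hv
  rw [← hover.over] at h
  have hcard : Nat.card (ℤ ⧸ Ideal.span {(p : ℤ)}) = p := by
    rw [Nat.card_congr (Int.quotientSpanNatEquivZMod p).toEquiv, Nat.card_zmod]
  rw [hcard] at h
  exact h

/-- Write `x = a/b` with `b ∉ v`. Frobenius of `b` is congruent to `b ^ p`, hence also a unit at
`v`, and clearing denominators reduces to the congruence on `𝓞 K`. -/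
lemma frob_congr_pow {v : HeightOneSpectrum (𝓞 K)} {p : ℕ} (hp : p.Prime)
    (hunr : UnramifiedPrime K p) (hv : (p : 𝓞 K) ∈ v.asIdeal) (x : K)
    (hx : x ∈ (v.valuation K).integer) :
    ∃ y ∈ (v.valuation K).integer, (frob v : K →+* K) x - x ^ p = p * y := by
  apply exists_eq_natCast_mul hp hunr hv
  obtain ⟨a, ⟨b, hb⟩, hab⟩ := v.exists_primeCompl_mul_eq_of_integer x hx
  have hb : b ∉ v.asIdeal := hb
  have hbp : b ^ p ∉ v.asIdeal := fun h => hb (v.isPrime.mem_of_pow_mem p h)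
  have hσb : frob v • b ∉ v.asIdeal := fun h => hbp (by
    have := sub_mem h (frob_sub_pow_mem hp hv b)
    simpa using this)
  have hcoe : ∀ z : 𝓞 K, algebraMap (𝓞 K) K (frob v • z) = frob v (algebraMap (𝓞 K) K z) :=
    fun z => rfl
  have hnum : (frob v • a) * b ^ p - a ^ p * (frob v • b) ∈ v.asIdeal := by
    have h1 := Ideal.mul_mem_right (b ^ p) _ (frob_sub_pow_mem hp hv a)
    have h2 := Ideal.mul_mem_left _ (a ^ p) (frob_sub_pow_mem hp hv b)
    convert sub_mem h1 h2 using 1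
    ring
  have hden : (frob v • b) * b ^ p ∉ v.asIdeal := fun h =>
    (v.isPrime.mem_or_mem h).elim hσb hbp
  have hval : v.valuation K (algebraMap (𝓞 K) K _) < 1 :=
    (HeightOneSpectrum.valuation_lt_one_iff_mem (K := K) v _).2 hnum
  have hval' := (HeightOneSpectrum.valuation_eq_one_iff_notMem (K := K) v).2 hden
  have heq : algebraMap (𝓞 K) K ((frob v • a) * b ^ p - a ^ p * (frob v • b)) =
      ((frob v : K →+* K) x - x ^ p) * algebraMap (𝓞 K) K ((frob v • b) * b ^ p) := by
    simp only [map_sub, map_mul, map_pow, hcoe, ← hab]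
    simp only [RingHom.coe_coe]
    ring
  rw [heq, map_mul, hval', mul_one] at hval
  exact hval

lemma frobPow_eq (v : HeightOneSpectrum (𝓞 K)) {p : ℕ} (hp : p ≠ 0) (V : K⟦X⟧) :
    frobPow v p V = frobLift (frob v : K →+* K) p hp V := by
  rw [frobPow, ← expand_apply p hp]
  rfl

/-- The factor `z^(-pn)` shifts the constant term to the `pn`-th coefficient of a power series. -/
lemma framingTerm_eq (v : HeightOneSpectrum (𝓞 K)) {p : ℕ} (hp : p ≠ 0) (n : ℕ) (ν : K)
    (V : K⟦X⟧) : framingTerm v p n ν V =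
      coeff (p * n) (euler (frobLift (frob v : K →+* K) p hp V + V) *
        expSeries (ν • logInt V) ^ (p * n) *
        logInt (logInt (logInt (frobLift (frob v : K →+* K) p hp V - V)))) := by
  have hexp : expOverZ ν V = ((expSeries (ν • logInt V) : K⟦X⟧) : LaurentSeries K) *
    HahnSeries.single (-1 : ℤ) (1 : K) := rfl
  rw [framingTerm, frobPow_eq v hp, hexp]
  generalize euler (frobLift (frob v : K →+* K) p hp V + V) = A
  generalize expSeries (ν • logInt V) = E
  generalize logInt (logInt (logInt (frobLift (frob v : K →+* K) p hp V - V))) = G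
  rw [mul_pow, HahnSeries.single_pow, one_pow]
  have : (A : LaurentSeries K) * ((E : LaurentSeries K) ^ (p * n) *
      HahnSeries.single ((p * n) • (-1 : ℤ)) (1 : K)) * (G : LaurentSeries K) =
      ((A * E ^ (p * n) * G : K⟦X⟧) : LaurentSeries K) *
        HahnSeries.single ((p * n) • (-1 : ℤ)) (1 : K) := by
    simp only [map_mul, map_pow]
    ring
  rw [this]
  have h := HahnSeries.coeff_mul_single_add (r := (1 : K))
    (x := ((A * E ^ (p * n) * G : K⟦X⟧) : LaurentSeries K)) (a := ((p * n : ℕ) : ℤ))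
    (b := (p * n) • (-1 : ℤ))
  rw [show ((p * n : ℕ) : ℤ) + (p * n) • (-1 : ℤ) = 0 by simp, mul_one] at h
  rw [h]
  exact LaurentSeries.coeff_coe_powerSeries _ _

/-- For an index `p^r m` with `p ∤ m`, the congruence modulo `p^(3r)` exactly absorbs the
denominator `(p^r m)³`. If `r = 0`, the lift contributes nothing and the denominator is a unit. -/
lemma logInt_cube_mem {v : HeightOneSpectrum (𝓞 K)} {p : ℕ} (hp : p.Prime)
    (hv : (p : 𝓞 K) ∈ v.asIdeal) {V : K⟦X⟧} (hV : V ∈ coeffSubring (v.valuation K).integer)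
    (h : ∀ m r : ℕ, 0 < m → 0 < r →
      LocCongr v p (3 * r) (frob v (coeff (m * p ^ (r - 1)) V)) (coeff (m * p ^ r) V)) :
    logInt (logInt (logInt (frobLift (frob v : K →+* K) p hp.ne_zero V - V))) ∈
      coeffSubring (v.valuation K).integer := by
  rw [mem_coeffSubring]
  intro n
  rcases Nat.eq_zero_or_pos n with rfl | hn
  · simp
  obtain ⟨r, m, hpm, rfl⟩ := Nat.exists_eq_pow_mul_and_not_dvd hn.ne' p hp.ne_one
  have hm : 0 < m := Nat.pos_of_ne_zero (by rintro rfl; simp at hn)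
  have hm0 : (m : K) ≠ 0 := by exact_mod_cast hm.ne'
  have hp0 : (p : K) ≠ 0 := by exact_mod_cast hp.ne_zero
  have hminv := pow_mem (natCast_inv_mem_integer hp hv m hpm) 3
  simp only [coeff_logInt, map_sub]
  rcases Nat.eq_zero_or_pos r with rfl | hr
  · rw [pow_zero, one_mul, coeff_frobLift, if_neg hpm, zero_sub]
    convert neg_mem (mul_mem (mem_coeffSubring.1 hV m) hminv) using 1
    field_simp
  · obtain ⟨c, hc, hcc⟩ := exists_eq_of_locCongr hp.ne_zero (h m r hm hr)
    obtain ⟨s, rfl⟩ := Nat.exists_eq_add_of_le' hr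
    have hU : coeff (p ^ (s + 1) * m) (frobLift (frob v : K →+* K) p hp.ne_zero V) =
        frob v (coeff (m * p ^ s) V) := by
      rw [show p ^ (s + 1) * m = p * (m * p ^ s) by ring, coeff_mul_frobLift]
      rfl
    rw [Nat.add_sub_cancel] at hcc
    rw [hU, mul_comm (p ^ (s + 1)) m, hcc]
    convert mul_mem hc hminv using 1
    push_cast
    field_simp
    ring

end NumberFieldPlaces

end Framing

end

theorem mainTheorem5 (K : Type*) [Field K] [NumberField K] [IsGalois ℚ K]
    (V : PowerSeries K) (hV : Framing.IsSFunction 3 V)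
    (ν : ℚ) (hν : ν ∈ Algebra.adjoin ℤ {((NumberField.discr K : ℚ))⁻¹})
    (p : ℕ) (hp : p.Prime) (hunr : Framing.UnramifiedPrime K p)
    (v : IsDedekindDomain.HeightOneSpectrum (NumberField.RingOfIntegers K))
    (hv : (p : NumberField.RingOfIntegers K) ∈ v.asIdeal)
    (n : ℕ) (hn : 0 < n) :
    (¬ (p = 2 ∧ padicValNat 2 n = 0) →
      Framing.LocCongr v p (padicValNat p (p * n) - if p = 3 then 1 else 0)
        (2 / ((p : K) ^ 2 * (n : K) ^ 2) *
          (Framing.frob v (PowerSeries.coeff n (Framing.framingPlus (ν : K) V)) -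
            PowerSeries.coeff (p * n) (Framing.framingPlus (ν : K) V)))
        ((ν : K) * Framing.framingTerm v p n (ν : K) V)) ∧
    (p = 2 ∧ padicValNat 2 n = 0 →
      Framing.LocCongr v 2 1
        (Framing.frob v (PowerSeries.coeff n (Framing.framingPlus (ν : K) V)))
        (PowerSeries.coeff (2 * n) (Framing.framingPlus (ν : K) V))) := by
  obtain ⟨hV0, hVp⟩ := hV
  obtain ⟨hVint, hVcongr⟩ := (hVp p hp hunr).2 v hv
  have hVO : V ∈ Framing.coeffSubring (v.valuation K).integer := by
    rw [Framing.mem_coeffSubring]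
    intro m
    rcases Nat.eq_zero_or_pos m with rfl | hm
    · simp [hV0]
    · exact Framing.isLocInt_iff.1 (hVint m hm)
  obtain ⟨h1, h2⟩ := Framing.framing_congruences (σ := (Framing.frob v : K →+* K)) hp
    (Framing.natCast_inv_mem_integer hp hv) (Framing.frob_congr_pow hp hunr hv) hV0 hVO
    (Framing.logInt_cube_mem hp hv hVO hVcongr) (Framing.ratCast_mem_integer hp hunr hv hν)
    (map_ratCast _ ν) hn
  constructor
  · intro hpn
    have : Fact p.Prime := ⟨hp⟩
    obtain ⟨y, hy, hye⟩ := h2 (by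
      rintro rfl
      by_contra h
      exact hpn ⟨rfl, padicValNat.eq_zero_of_not_dvd h⟩)
    obtain ⟨u, hu⟩ := pow_padicValNat_dvd (p := p) (n := p * n)
    -- Ensures that the truncated subtraction in the exponent is a true one, so the factor `p ^ (if
    -- p = 3 then 1 else 0)` can be cancelled.
    have hpos : 1 ≤ padicValNat p (p * n) :=
      one_le_padicValNat_of_dvd (Nat.mul_pos hp.pos hn).ne' (dvd_mul_right p n)
    have hp0 : (p : K) ≠ 0 := by exact_mod_cast hp.ne_zero
    refine Framing.locCongr_of_eq (mul_mem (natCast_mem _ u) hy) ?_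
    apply mul_left_cancel₀ (pow_ne_zero (if p = 3 then 1 else 0) hp0)
    rw [Framing.framingTerm_eq v hp.ne_zero]
    refine hye.trans ?_
    rw [← mul_assoc, ← pow_add, Nat.add_sub_cancel' (by split_ifs <;> lia), ← mul_assoc]
    congr 1
    exact_mod_cast hu
  · rintro ⟨rfl, -⟩
    obtain ⟨y, hy, hye⟩ := h1
    exact Framing.locCongr_of_eq hy (by rw [pow_one]; exact hye)
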